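/- Let $\Phi:[0,\infty)\to\mathbb R$ be a continuous, non-decreasing, concave function such that $\Phi(x)/x\to0$ as $x\to\infty$ and $\Phi(0)<\log 2$. Assume that on a neighbourhood of $+\infty$ the function $\Phi$ is $\mathcal C^2$ and, for some $\theta>1$, $\Phi^\theta$ is convex there. Assume that $Z_\Phi=\int_{\mathbb R}e^{-\Phi(|x|)}\,dx<\infty$, let $\mu$ be the probability measure $d\mu(x)=Z_\Phi^{-1}e^{-\Phi(|x|)}\,dx$ on $\mathbb R$, and let $\mu^n$ be its $n$-fold product on $\mathbb R^n$. (Then $\Phi$ is a strictly increasing bijection onto $[\Phi(0),\infty)$; $\Phi^{-1}$ denotes its inverse and $\Phi'$ its right derivative.) For a Borel probability measure $\nu$ on $\mathbb R^n$ with the Euclidean distance $d$ and a Borel set $A\subset\mathbb R^n$, put $\nu_s(\partial A)=\liminf_{h\to0^+}\nu(A_h\setminus A)/h$, where $A_h=\{x: d(x,A)\le h\}$ and $d(x,\emptyset)=+\infty$, and let $I_\nu(a)=\inf\{\nu_s(\partial A): A \text{ Borel},\ \nu(A)=a\}$ for $a\in[0,1]$ be the isoperimetric profile. Then there exists a constant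 $c>0$, depending only on $\Phi$ and not on $n$, such that for all integers $n\ge1$ and all $t\in[0,1]$, $$I_{\mu^n}(t)\ \ge\ c\,\min(t,1-t)\;\Phi'\circ\Phi^{-1}\!\left(\log\frac{n}{\min(t,1-t)}\right),$$ where the right-hand side is read as $0$ when $t\in\{0,1\}$. -/

import Mathlib

open MeasureTheory Set Filter Topology

namespace HeavyTail

/-- The measure `Z⁻¹ exp (-Φ |x|) dx` on the real line, with `Z = ∫ exp (-Φ |x|) dx`.
Only the values of `Φ` on `[0, ∞)` matter. -/
noncomputable def muPhi (Φ : ℝ → ℝ) : Measure ℝ :=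
  volume.withDensity fun x : ℝ =>
    ENNReal.ofReal ((∫ y : ℝ, Real.exp (-Φ |y|))⁻¹ * Real.exp (-Φ |x|))

/-- The `n`-fold product measure `μⁿ`, on `ℝⁿ` with its Euclidean distance. -/
noncomputable def prodMeasure (μ : Measure ℝ) (n : ℕ) : Measure (EuclideanSpace ℝ (Fin n)) :=
  (Measure.pi fun _ : Fin n => μ).map (MeasurableEquiv.toLp 2 (Fin n → ℝ))

/-- The boundary measure `μ_s(∂A) = liminf_{h → 0⁺} μ (A_h \ A) / h`, where
`A_h = {x | d(x, A) ≤ h}` is the closed `h`-enlargement of `A` (empty if `A` is empty). -/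
noncomputable def boundaryMeasure {M : Type*} [PseudoEMetricSpace M] [MeasurableSpace M]
    (μ : Measure M) (A : Set M) : ENNReal :=
  liminf (fun h : ℝ => μ (Metric.cthickening h A \ A) / ENNReal.ofReal h) (𝓝[>] (0 : ℝ))

/-- The isoperimetric profile `I_μ(a) = inf {μ_s(∂A) | A Borel, μ(A) = a}`. -/
noncomputable def isoProfile {M : Type*} [PseudoEMetricSpace M] [MeasurableSpace M]
    (μ : Measure M) (a : ℝ) : ENNReal :=
  sInf {b | ∃ A : Set M, MeasurableSet A ∧ μ A = ENNReal.ofReal a ∧ b = boundaryMeasure μ A}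

/-- The right derivative of `Φ` at `x`. -/
noncomputable def rightDeriv (Φ : ℝ → ℝ) (x : ℝ) : ℝ :=
  derivWithin Φ (Ioi x) x

/-- The inverse `Φ⁻¹` of `Φ`, as a function on `[0, ∞)`. -/
noncomputable def halfLineInv (Φ : ℝ → ℝ) : ℝ → ℝ :=
  Function.invFunOn Φ (Ici 0)

end HeavyTail

namespace HeavyTail

/-! Write `J p = p * (1 - p)`. The proof rests on a functional inequality with an additive error, `J
(∫ f) ≤ ∫ √(J(f)² + c |∇f|²) + s`. On the line, a Hardy-type integration by parts on `[-M, M]` gives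
it with `√c` of order `1 / σ`, where `σ` is the slope of a chord of `Φ` beyond `M`; the mass outside
`[-M, M]` is the error `s` (`functional_ineq_muPhi`).

This form tensorizes: `c` is unchanged and the error becomes `n * s` (`functional_ineq_pi`). Testing
it on smoothed indicators bounds the measure of enlargements from below
(`mul_one_sub_le_measure_cthickening`).

It remains to choose `M`. Put `m = min t (1 - t)` and let `Φ x = log (n / m)`, so that `exp (-Φ x) =
m / n`. Convexity of `Φ ^ θ` yields a fixed `l` with `Φ (l x) ≥ 2 Φ x`, and at `M = l x` the tail is
at most `m / (4 n)` (`exists_doubling_scale`). The total error `m / 4` is then half of the lower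
bound `m / 2` for `J t`. The chord over `[l x, l² x]` has slope at least `Φ x / (l² x)`, which
dominates `Φ' x` up to a constant by concavity. -/

/-! ### The functional inequality on the line -/

/-- Used with `a = J(f)`, `b = L f'`, `g = f - f 0`. If the left side `m` is positive, it is at most
both `4|b|` and `4b²`, so `m² ≤ 16b²` and `2am ≤ m / 2 ≤ 2b²`; this is where `18 = 16 + 2` comes
from. -/
lemma four_mul_sub_sq_le_sqrt {a b g : ℝ} (ha : 0 ≤ a) (ha' : a ≤ 1 / 4) (hg : |g| ≤ 1) :
    4 * (|g| * |b|) - g ^ 2 ≤ √(a ^ 2 + 18 * b ^ 2) - a := by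
  rw [← sq_abs g, ← sq_abs b]
  generalize |g| = u at *
  have hb := abs_nonneg b
  generalize |b| = v at *
  set m := 4 * (u * v) - u ^ 2 with hm
  have h1 : m ≤ 4 * v ^ 2 := by nlinarith [sq_nonneg (u - 2 * v)]
  have h2 : m ≤ 4 * v := by nlinarith [sq_nonneg u]
  rw [le_sub_iff_add_le]
  rcases le_or_gt m 0 with h0 | h0
  · calc m + a ≤ a := by linarith
      _ = √(a ^ 2) := (Real.sqrt_sq ha).symm
      _ ≤ _ := Real.sqrt_le_sqrt (by nlinarith [sq_nonneg v])
  · apply Real.le_sqrt_of_sq_le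
    nlinarith [mul_nonneg h0.le (sub_nonneg.2 ha'), mul_self_le_mul_self h0.le h2]

lemma mul_one_sub_mem {p : ℝ} (h0 : 0 ≤ p) (h1 : p ≤ 1) :
    0 ≤ p * (1 - p) ∧ p * (1 - p) ≤ 1 / 4 :=
  ⟨mul_nonneg h0 (by linarith), by nlinarith [sq_nonneg (p - 1 / 2)]⟩

lemma le_sqrt_sq_add {a b : ℝ} (ha : 0 ≤ a) (hb : 0 ≤ b) : a ≤ √(a ^ 2 + b) := by
  calc a = √(a ^ 2) := (Real.sqrt_sq ha).symm
    _ ≤ _ := Real.sqrt_le_sqrt (by linarith)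

lemma intervalIntegrable_of_measurable_of_bound {u : ℝ → ℝ} (hu : Measurable u) {C : ℝ}
    (hC : ∀ x, |u x| ≤ C) (a b : ℝ) : IntervalIntegrable u volume a b := by
  refine (intervalIntegrable_const (c := C)).mono_fun' hu.aestronglyMeasurable ?_
  exact ae_of_all _ fun x => by simpa using hC x

/-- The integrand in the functional inequality on the line. -/
lemma measurable_sqrt_integrand {f : ℝ → ℝ} (hf : Measurable f) (c : ℝ) :
    Measurable fun x => √((f x * (1 - f x)) ^ 2 + c * deriv f x ^ 2) := by
  have := measurable_deriv f
  fun_prop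

lemma sqrt_integrand_le {f : ℝ → ℝ} {B c : ℝ} (hc : 0 ≤ c) (hB : ∀ x, |deriv f x| ≤ B)
    (h0 : ∀ x, 0 ≤ f x) (h1 : ∀ x, f x ≤ 1) (x : ℝ) :
    √((f x * (1 - f x)) ^ 2 + c * deriv f x ^ 2) ≤ √(1 + c * B ^ 2) := by
  apply Real.sqrt_le_sqrt
  have := mul_one_sub_mem (h0 x) (h1 x)
  have h2 : deriv f x ^ 2 ≤ B ^ 2 := by
    rw [← sq_abs]
    exact pow_le_pow_left₀ (abs_nonneg _) (hB x) 2
  have h3 := mul_le_mul_of_nonneg_left h2 hc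
  nlinarith

/-- With `g = f - f 0` and the truncated tail `R x = ∫ y in x..M, ρ y`, the boundary terms of `g² R`
vanish because `g 0 = 0` and `R M = 0`. Hence `∫ g² ρ = 2 ∫ g f' R`, and `R ≤ L ρ` reduces the claim
to a pointwise bound. -/
lemma integral_sq_sub_mul_le {f ρ : ℝ → ℝ} {M L B : ℝ} (hM : 0 ≤ M)
    (hρ : Continuous ρ) (hρ0 : ∀ x, 0 ≤ ρ x) (hR : ∀ x ∈ Icc 0 M, ∫ y in x..M, ρ y ≤ L * ρ x)
    (hf : Differentiable ℝ f) (hB : ∀ x, |deriv f x| ≤ B)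
    (h0 : ∀ x, 0 ≤ f x) (h1 : ∀ x, f x ≤ 1) :
    ∫ x in (0 : ℝ)..M, (f x - f 0) ^ 2 * ρ x ≤
      ∫ x in (0 : ℝ)..M, (√((f x * (1 - f x)) ^ 2 + 18 * L ^ 2 * deriv f x ^ 2)
        - f x * (1 - f x)) * ρ x := by
  set g : ℝ → ℝ := fun x => f x - f 0 with hg
  have hgc : Continuous g := hf.continuous.sub continuous_const
  have hg1 : ∀ x, |g x| ≤ 1 := fun x => by
    rw [abs_le]; constructor <;> simp only [hg] <;> linarith [h0 x, h1 x, h0 0, h1 0]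
  set R : ℝ → ℝ := fun x => ∫ y in x..M, ρ y with hRdef
  have hRd : ∀ x, HasDerivAt R (-ρ x) x := fun x =>
    intervalIntegral.integral_hasDerivAt_left (hρ.intervalIntegrable _ _)
      (hρ.stronglyMeasurableAtFilter _ _) hρ.continuousAt
  have hRc : Continuous R := continuous_iff_continuousAt.2 fun x => (hRd x).continuousAt
  have hd' : IntervalIntegrable (deriv f) volume 0 M :=
    intervalIntegrable_of_measurable_of_bound (measurable_deriv f) hB _ _
  have hI1 : IntervalIntegrable (fun x => g x * deriv f x * R x) volume 0 M := by
    have := hd'.mul_continuousOn (hgc.mul hRc).continuousOn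
    exact this.congr fun x _ => by simp only [Pi.mul_apply]; ring
  have hI2 : IntervalIntegrable (fun x => g x ^ 2 * ρ x) volume 0 M :=
    ((hgc.pow 2).mul hρ).intervalIntegrable _ _
  have hder : ∀ x, HasDerivAt (fun x => g x ^ 2 * R x)
      (2 * (g x * deriv f x * R x) - g x ^ 2 * ρ x) x := fun x => by
    have h := (((hf x).hasDerivAt.sub_const (f 0)).fun_pow 2).mul (hRd x)
    refine h.congr_deriv ?_
    simp only [hg]; push_cast; ring
  have hparts := intervalIntegral.integral_eq_sub_of_hasDerivAt (a := 0) (b := M)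
    (fun x _ => hder x) ((hI1.const_mul 2).sub hI2)
  rw [intervalIntegral.integral_sub (hI1.const_mul 2) hI2,
    intervalIntegral.integral_const_mul] at hparts
  have hz : g M ^ 2 * R M - g 0 ^ 2 * R 0 = 0 := by simp [hg, hRdef]
  rw [hz] at hparts
  -- Writing `∫ g² ρ` as twice itself minus itself creates the term `-g² ρ` required by
  -- `four_mul_sub_sq_le_sqrt`.
  have hkey : ∫ x in (0 : ℝ)..M, g x ^ 2 * ρ x
      = ∫ x in (0 : ℝ)..M, (4 * (g x * deriv f x * R x) - g x ^ 2 * ρ x) := by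
    rw [intervalIntegral.integral_sub (hI1.const_mul 4) hI2,
      intervalIntegral.integral_const_mul]
    linarith
  rw [hkey]
  have hψ := measurable_sqrt_integrand hf.continuous.measurable (18 * L ^ 2)
  refine intervalIntegral.integral_mono_on hM ((hI1.const_mul 4).sub hI2) ?_ ?_
  · refine IntervalIntegrable.mul_continuousOn ?_ hρ.continuousOn
    refine IntervalIntegrable.sub (intervalIntegrable_of_measurable_of_bound hψ
      (C := √(1 + 18 * L ^ 2 * B ^ 2)) (fun x => ?_) _ _)
      ((hf.continuous.mul (continuous_const.sub hf.continuous)).intervalIntegrable _ _)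
    rw [abs_of_nonneg (Real.sqrt_nonneg _)]
    exact sqrt_integrand_le (by positivity) hB h0 h1 x
  · intro x hx
    have hR0 : 0 ≤ R x := intervalIntegral.integral_nonneg hx.2 fun y _ => hρ0 y
    have hRx := hR x hx
    have hpt := four_mul_sub_sq_le_sqrt (b := L * deriv f x) (mul_one_sub_mem (h0 x) (h1 x)).1
      (mul_one_sub_mem (h0 x) (h1 x)).2 (hg1 x)
    have hLabs : L * ρ x ≤ |L| * ρ x := mul_le_mul_of_nonneg_right (le_abs_self L) (hρ0 x)
    have h3 : g x * deriv f x * R x ≤ |g x| * |L * deriv f x| * ρ x := by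
      calc g x * deriv f x * R x ≤ |g x * deriv f x| * R x :=
            mul_le_mul_of_nonneg_right (le_abs_self _) hR0
        _ ≤ |g x * deriv f x| * (|L| * ρ x) :=
            mul_le_mul_of_nonneg_left (hRx.trans hLabs) (abs_nonneg _)
        _ = _ := by rw [abs_mul, abs_mul]; ring
    have h4 := mul_le_mul_of_nonneg_right hpt (hρ0 x)
    rw [mul_pow L, ← mul_assoc 18] at h4
    linarith

lemma integral_sq_sub_mul_le_symm {f ρ : ℝ → ℝ} {M L B : ℝ} (hM : 0 ≤ M)
    (hρ : Continuous ρ) (hρ0 : ∀ x, 0 ≤ ρ x) (hρe : ∀ x, ρ (-x) = ρ x)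
    (hR : ∀ x ∈ Icc 0 M, ∫ y in x..M, ρ y ≤ L * ρ x)
    (hf : Differentiable ℝ f) (hB : ∀ x, |deriv f x| ≤ B)
    (h0 : ∀ x, 0 ≤ f x) (h1 : ∀ x, f x ≤ 1) :
    ∫ x in (-M)..M, (f x - f 0) ^ 2 * ρ x ≤
      ∫ x in (-M)..M, (√((f x * (1 - f x)) ^ 2 + 18 * L ^ 2 * deriv f x ^ 2)
        - f x * (1 - f x)) * ρ x := by
  have hI1 : ∀ a b, IntervalIntegrable (fun x => (f x - f 0) ^ 2 * ρ x) volume a b :=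
    fun a b => (((hf.continuous.sub continuous_const).pow 2).mul hρ).intervalIntegrable _ _
  have hI2 : ∀ a b, IntervalIntegrable (fun x => (√((f x * (1 - f x)) ^ 2
      + 18 * L ^ 2 * deriv f x ^ 2) - f x * (1 - f x)) * ρ x) volume a b := fun a b => by
    refine IntervalIntegrable.mul_continuousOn ?_ hρ.continuousOn
    refine IntervalIntegrable.sub (intervalIntegrable_of_measurable_of_bound
      (measurable_sqrt_integrand hf.continuous.measurable (18 * L ^ 2))
      (C := √(1 + 18 * L ^ 2 * B ^ 2)) (fun x => ?_) _ _)
      ((hf.continuous.mul (continuous_const.sub hf.continuous)).intervalIntegrable _ _)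
    rw [abs_of_nonneg (Real.sqrt_nonneg _)]
    exact sqrt_integrand_le (by positivity) hB h0 h1 x
  have hright := integral_sq_sub_mul_le hM hρ hρ0 hR hf hB h0 h1
  have hd : ∀ x, deriv (fun x => f (-x)) x = -deriv f (-x) := fun x => deriv_comp_neg f x
  have hleft := integral_sq_sub_mul_le (f := fun x => f (-x)) (B := B) hM hρ hρ0 hR
    (hf.comp differentiable_neg) (fun x => by rw [hd, abs_neg]; exact hB _)
    (fun x => h0 _) (fun x => h1 _)
  simp only [hd, neg_sq, neg_zero] at hleft
  have e1 := intervalIntegral.integral_comp_neg (a := 0) (b := M)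
    (fun x => (f x - f 0) ^ 2 * ρ x)
  have e2 := intervalIntegral.integral_comp_neg (a := 0) (b := M)
    (fun x => (√((f x * (1 - f x)) ^ 2 + 18 * L ^ 2 * deriv f x ^ 2)
        - f x * (1 - f x)) * ρ x)
  simp only [hρe, neg_zero] at e1 e2
  rw [e1, e2] at hleft
  rw [← intervalIntegral.integral_add_adjacent_intervals (hI1 (-M) 0) (hI1 0 M),
    ← intervalIntegral.integral_add_adjacent_intervals (hI2 (-M) 0) (hI2 0 M)]
  exact add_le_add hleft hright

/-- A weak functional isoperimetric inequality on the line: the mass outside `[-M, M]` is paid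
for by an additive error. -/
lemma functional_ineq_line {μ : Measure ℝ} [IsProbabilityMeasure μ] {ρ : ℝ → ℝ} {M L B : ℝ}
    (hμ : μ = volume.withDensity fun x => ENNReal.ofReal (ρ x)) (hM : 0 ≤ M)
    (hρ : Continuous ρ) (hρ0 : ∀ x, 0 ≤ ρ x) (hρe : ∀ x, ρ (-x) = ρ x)
    (hR : ∀ x ∈ Icc 0 M, ∫ y in x..M, ρ y ≤ L * ρ x)
    {f : ℝ → ℝ} (hf : Differentiable ℝ f) (hB : ∀ x, |deriv f x| ≤ B)
    (h0 : ∀ x, 0 ≤ f x) (h1 : ∀ x, f x ≤ 1) :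
    (∫ x, f x ∂μ) * (1 - ∫ x, f x ∂μ) ≤
      ∫ x, √((f x * (1 - f x)) ^ 2 + 18 * L ^ 2 * deriv f x ^ 2) ∂μ + μ.real (Ioc (-M) M)ᶜ := by
  have hset : ∀ (u : ℝ → ℝ), ∫ x in Ioc (-M) M, u x ∂μ = ∫ x in (-M)..M, u x * ρ x := by
    intro u
    rw [intervalIntegral.integral_of_le (by linarith), hμ,
      setIntegral_withDensity_eq_setIntegral_toReal_smul (by fun_prop)
        (ae_of_all _ fun x => ENNReal.ofReal_lt_top) _ measurableSet_Ioc]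
    refine integral_congr_ae (ae_of_all _ fun x => ?_)
    simp only [smul_eq_mul, ENNReal.toReal_ofReal (hρ0 x)]
    ring
  have hfm : Measurable f := hf.continuous.measurable
  have hint : ∀ {u : ℝ → ℝ} (_ : Measurable u) (C : ℝ) (_ : ∀ x, |u x| ≤ C), Integrable u μ :=
    fun hu C hC => Integrable.of_bound hu.aestronglyMeasurable C (ae_of_all _ hC)
  have hfi : Integrable f μ := hint hfm 1 fun x => by rw [abs_of_nonneg (h0 x)]; exact h1 x
  have hf2 : Integrable (fun x => f x ^ 2) μ := hint (by fun_prop) 1 fun x => by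
    rw [abs_of_nonneg (sq_nonneg _)]; exact pow_le_one₀ (h0 x) (h1 x)
  have hJ : Integrable (fun x => f x * (1 - f x)) μ := by
    refine (hfi.sub hf2).congr (ae_of_all _ fun x => ?_)
    simp only [Pi.sub_apply]; ring
  have hψ : Integrable (fun x => √((f x * (1 - f x)) ^ 2 + 18 * L ^ 2 * deriv f x ^ 2)) μ :=
    hint (measurable_sqrt_integrand hfm _) (√(1 + 18 * L ^ 2 * B ^ 2)) fun x => by
      rw [abs_of_nonneg (Real.sqrt_nonneg _)]
      exact sqrt_integrand_le (by positivity) hB h0 h1 x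
  have hg : Integrable (fun x => (f x - f 0) ^ 2) μ := by
    refine ((hf2.sub (hfi.const_mul (2 * f 0))).add (integrable_const (f 0 ^ 2))).congr
      (ae_of_all _ fun x => ?_)
    simp only [Pi.sub_apply, Pi.add_apply]; ring
  have hmain := integral_sq_sub_mul_le_symm hM hρ hρ0 hρe hR hf hB h0 h1
  rw [← hset, ← hset] at hmain
  have hsplit := integral_add_compl (measurableSet_Ioc (a := -M) (b := M)) hg
  have hout : ∫ x in (Ioc (-M) M)ᶜ, (f x - f 0) ^ 2 ∂μ ≤ μ.real (Ioc (-M) M)ᶜ := by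
    calc ∫ x in (Ioc (-M) M)ᶜ, (f x - f 0) ^ 2 ∂μ ≤ ∫ x in (Ioc (-M) M)ᶜ, (1 : ℝ) ∂μ := by
          refine integral_mono hg.integrableOn (integrable_const _) fun x => ?_
          simp only []
          rw [← sq_abs]
          refine pow_le_one₀ (abs_nonneg _) ?_
          rw [abs_le]; constructor <;> linarith [h0 x, h1 x, h0 0, h1 0]
      _ = _ := by simp
  have hin : ∫ x in Ioc (-M) M, (√((f x * (1 - f x)) ^ 2 + 18 * L ^ 2 * deriv f x ^ 2)
        - f x * (1 - f x)) ∂μ ≤ ∫ x, (√((f x * (1 - f x)) ^ 2 + 18 * L ^ 2 * deriv f x ^ 2)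
        - f x * (1 - f x)) ∂μ := by
    refine setIntegral_le_integral (hψ.sub hJ) (ae_of_all _ fun x => ?_)
    exact sub_nonneg.2 (le_sqrt_sq_add (mul_one_sub_mem (h0 x) (h1 x)).1 (by positivity))
  rw [integral_sub hψ hJ] at hin
  have eJ : ∫ x, f x * (1 - f x) ∂μ = ∫ x, f x ∂μ - ∫ x, f x ^ 2 ∂μ := by
    rw [← integral_sub hfi hf2]
    exact integral_congr_ae (ae_of_all _ fun x => by simp only []; ring)
  have eg : ∫ x, (f x - f 0) ^ 2 ∂μ
      = ∫ x, f x ^ 2 ∂μ - 2 * f 0 * ∫ x, f x ∂μ + f 0 ^ 2 := by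
    have : ∀ x, (f x - f 0) ^ 2 = f x ^ 2 - 2 * f 0 * f x + f 0 ^ 2 := fun x => by ring
    simp only [this]
    rw [integral_add (by exact hf2.sub (hfi.const_mul _)) (integrable_const _),
      integral_sub hf2 (hfi.const_mul _), integral_const_mul]
    simp
  -- `J (∫ f) = ∫ J(f) + Var f`, and the variance is at most the second moment about `f 0`.
  nlinarith [sq_nonneg (∫ x, f x ∂μ - f 0)]

/-! ### Tensorization -/

/-- The triangle inequality for the integral of the complex function `a + i b`. -/
lemma sqrt_sq_add_sq_integral_le {α : Type*} [MeasurableSpace α] {μ : Measure α} {a b : α → ℝ}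
    (ha : Integrable a μ) (hb : Integrable b μ) :
    √((∫ x, a x ∂μ) ^ 2 + (∫ x, b x ∂μ) ^ 2) ≤ ∫ x, √(a x ^ 2 + b x ^ 2) ∂μ := by
  have h := norm_integral_le_integral_norm (μ := μ)
    (fun x => (a x : ℂ) + (b x : ℂ) * Complex.I)
  rw [integral_add ha.ofReal (hb.ofReal.mul_const _), integral_mul_const] at h
  simpa only [integral_complex_ofReal, Complex.norm_add_mul_I] using h

/-- Lets the error leave the square root with coefficient one, so that errors add up linearly in the
tensorization. -/
lemma sqrt_add_sq_add_le {a b s : ℝ} (ha : 0 ≤ a) (hb : 0 ≤ b) (hs : 0 ≤ s) :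
    √((a + s) ^ 2 + b) ≤ √(a ^ 2 + b) + s := by
  have h := le_sqrt_sq_add ha hb
  have h2 := Real.sq_sqrt (show 0 ≤ a ^ 2 + b by positivity)
  rw [Real.sqrt_le_left (by positivity)]
  nlinarith [mul_le_mul_of_nonneg_right h hs]

/-- The squared Euclidean norm of the gradient. -/
noncomputable def gradSq {n : ℕ} (F : (Fin n → ℝ) → ℝ) (x : Fin n → ℝ) : ℝ :=
  ∑ i, fderiv ℝ F x (Pi.single i 1) ^ 2

lemma gradSq_nonneg {n : ℕ} (F : (Fin n → ℝ) → ℝ) (x : Fin n → ℝ) : 0 ≤ gradSq F x :=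
  Finset.sum_nonneg fun _ _ => sq_nonneg _

lemma continuous_gradSq {n : ℕ} {F : (Fin n → ℝ) → ℝ} (hF : ContDiff ℝ 1 F) :
    Continuous (gradSq F) := by
  have := hF.continuous_fderiv one_ne_zero
  exact continuous_finsetSum _ fun i _ => (this.clm_apply continuous_const).pow 2

lemma gradSq_le {n : ℕ} {F : (Fin n → ℝ) → ℝ} {B : ℝ}
    (hB : ∀ x i, |fderiv ℝ F x (Pi.single i 1)| ≤ B) (x : Fin n → ℝ) : gradSq F x ≤ n * B ^ 2 := by
  calc gradSq F x ≤ ∑ _i : Fin n, B ^ 2 := Finset.sum_le_sum fun i _ => by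
        rw [← sq_abs]; exact pow_le_pow_left₀ (abs_nonneg _) (hB x i) 2
    _ = _ := by simp

lemma integral_pi_succ {μ : Measure ℝ} [IsProbabilityMeasure μ] {n : ℕ}
    {h : (Fin (n + 1) → ℝ) → ℝ} (hc : Continuous h) {C : ℝ} (hC : ∀ x, |h x| ≤ C) :
    ∫ z, h z ∂(Measure.pi fun _ => μ) =
      ∫ x, ∫ y, h (Fin.cons x y) ∂(Measure.pi fun _ : Fin n => μ) ∂μ := by
  have hmp := (measurePreserving_piFinSuccAbove (fun _ : Fin (n + 1) => μ) 0).symm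
  have e := hmp.integral_comp' (g := h)
  rw [← e, integral_prod]
  · simp [MeasurableEquiv.piFinSuccAbove, Fin.consEquiv]
  · refine Integrable.of_bound (C := C) ?_ (ae_of_all _ fun x => hC _)
    exact (hc.measurable.comp (MeasurableEquiv.measurable _)).aestronglyMeasurable

lemma fderiv_comp_cons_right {n : ℕ} {F : (Fin (n + 1) → ℝ) → ℝ} (hF : Differentiable ℝ F)
    (x : ℝ) (y : Fin n → ℝ) (i : Fin n) :
    fderiv ℝ (fun y : Fin n → ℝ => F (Fin.cons x y)) y (Pi.single i 1) =
      fderiv ℝ F (Fin.cons x y) (Pi.single i.succ 1) := by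
  have h : HasFDerivAt (fun y : Fin n → ℝ => (Fin.cons x y : Fin (n + 1) → ℝ))
      (ContinuousLinearMap.pi (Fin.cons (α := fun _ => (Fin n → ℝ) →L[ℝ] ℝ) 0
        fun k => ContinuousLinearMap.proj k)) y := by
    rw [hasFDerivAt_pi]
    intro j
    refine Fin.cases ?_ (fun k => ?_) j
    · exact hasFDerivAt_const x y
    · exact hasFDerivAt_apply k y
  have h2 := ((hF (Fin.cons x y)).hasFDerivAt.comp y h).fderiv
  have h3 : fderiv ℝ (fun y : Fin n → ℝ => F (Fin.cons x y)) y =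
    fderiv ℝ (F ∘ fun y : Fin n → ℝ => (Fin.cons x y : Fin (n + 1) → ℝ)) y := rfl
  rw [h3, h2, ContinuousLinearMap.comp_apply]
  congr 1
  ext j
  refine Fin.cases ?_ (fun k => ?_) j
  · simp
  · simp [Pi.single_apply, Fin.succ_inj]

lemma hasDerivAt_comp_cons_left {n : ℕ} {F : (Fin (n + 1) → ℝ) → ℝ} (hF : Differentiable ℝ F)
    (x : ℝ) (y : Fin n → ℝ) :
    HasDerivAt (fun x => F (Fin.cons x y)) (fderiv ℝ F (Fin.cons x y) (Pi.single 0 1)) x := by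
  have h : HasDerivAt (fun x : ℝ => (Fin.cons x y : Fin (n + 1) → ℝ)) (Pi.single 0 1) x := by
    rw [hasDerivAt_pi]
    intro j
    refine Fin.cases ?_ (fun k => ?_) j
    · simpa using hasDerivAt_id' x
    · simpa using hasDerivAt_const x (y k)
  exact (hF (Fin.cons x y)).hasFDerivAt.comp_hasDerivAt x h

lemma continuous_cons {n : ℕ} (x : ℝ) :
    Continuous fun y : Fin n → ℝ => (Fin.cons x y : Fin (n + 1) → ℝ) := by
  fun_prop

/-- Weak functional isoperimetric inequalities tensorize, the additive errors adding up. -/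
lemma functional_ineq_pi {μ : Measure ℝ} [IsProbabilityMeasure μ] {c s : ℝ} (hc : 0 ≤ c)
    (hs : 0 ≤ s)
    (H : ∀ (f : ℝ → ℝ) (B : ℝ), Differentiable ℝ f → (∀ x, |deriv f x| ≤ B) → (∀ x, 0 ≤ f x) →
      (∀ x, f x ≤ 1) → (∫ x, f x ∂μ) * (1 - ∫ x, f x ∂μ) ≤
        ∫ x, √((f x * (1 - f x)) ^ 2 + c * deriv f x ^ 2) ∂μ + s) (n : ℕ) :
    ∀ (F : (Fin n → ℝ) → ℝ) (B : ℝ), ContDiff ℝ 1 F →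
      (∀ x i, |fderiv ℝ F x (Pi.single i 1)| ≤ B) → (∀ x, 0 ≤ F x) → (∀ x, F x ≤ 1) →
      (∫ x, F x ∂(Measure.pi fun _ => μ)) * (1 - ∫ x, F x ∂(Measure.pi fun _ => μ)) ≤
        ∫ x, √((F x * (1 - F x)) ^ 2 + c * gradSq F x) ∂(Measure.pi fun _ => μ) + n * s := by
  induction n with
  | zero =>
    intro F B hF hB h0 h1
    have e : ∀ x, F x = F 0 := fun x => by rw [Subsingleton.elim x 0]
    simp only [e]
    rw [integral_const]
    simp only [probReal_univ, one_smul, gradSq, Finset.univ_eq_empty, Finset.sum_empty, mul_zero,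
      add_zero, integral_const, CharP.cast_eq_zero, zero_mul]
    rw [Real.sqrt_sq (mul_one_sub_mem (h0 0) (h1 0)).1]
  | succ n ih =>
    intro F B hF hB h0 h1
    set π : Measure (Fin n → ℝ) := Measure.pi fun _ => μ with hπ
    have hFd : Differentiable ℝ F := hF.differentiable one_ne_zero
    have hFc := hF.continuous
    have hgc := continuous_gradSq hF
    have hint : ∀ {u : (Fin n → ℝ) → ℝ} (_ : Continuous u) (C : ℝ) (_ : ∀ x, |u x| ≤ C),
        Integrable u π := fun hu C hC =>
      Integrable.of_bound hu.measurable.aestronglyMeasurable C (ae_of_all _ hC)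
    set g : ℝ → ℝ := fun x => ∫ y, F (Fin.cons x y) ∂π with hg
    have hFx : ∀ x, Integrable (fun y => F (Fin.cons x y)) π := fun x =>
      hint (hFc.comp (continuous_cons x)) 1 fun y => by rw [abs_of_nonneg (h0 _)]; exact h1 _
    have hpc : Continuous fun z => fderiv ℝ F z (Pi.single 0 1) :=
      (hF.continuous_fderiv one_ne_zero).clm_apply continuous_const
    have hpx : ∀ x, Integrable (fun y => fderiv ℝ F (Fin.cons x y) (Pi.single 0 1)) π := fun x =>
      hint (hpc.comp (continuous_cons x)) B fun y => hB _ _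
    have hgd : ∀ x, HasDerivAt g (∫ y, fderiv ℝ F (Fin.cons x y) (Pi.single 0 1) ∂π) x := fun x =>
      (hasDerivAt_integral_of_dominated_loc_of_deriv_le (bound := fun _ => B) univ_mem
        (Eventually.of_forall fun x => (hFx x).aestronglyMeasurable) (hFx x)
        (F' := fun x y => fderiv ℝ F (Fin.cons x y) (Pi.single 0 1))
        (hpx x).aestronglyMeasurable (ae_of_all _ fun y x _ => hB _ _) (integrable_const _)
        (ae_of_all _ fun y x _ => hasDerivAt_comp_cons_left hFd x y)).2
    have hg0 : ∀ x, 0 ≤ g x := fun x => integral_nonneg fun y => h0 _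
    have hg1 : ∀ x, g x ≤ 1 := fun x => by
      calc g x ≤ ∫ _, (1 : ℝ) ∂π := integral_mono (hFx x) (integrable_const _) fun y => h1 _
        _ = 1 := by simp
    have hgB : ∀ x, |deriv g x| ≤ B := fun x => by
      rw [(hgd x).deriv]
      have := norm_integral_le_of_norm_le_const (μ := π) (C := B)
        (f := fun y => fderiv ℝ F (Fin.cons x y) (Pi.single 0 1)) (ae_of_all _ fun y => hB _ _)
      simpa using this
    have hgdiff : Differentiable ℝ g := fun x => (hgd x).differentiableAt
    -- The one-dimensional inequality is applied to the marginal `g`, whose derivative is the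
    -- average of the first partial derivative of `F`.
    have h1d := H g B hgdiff hgB hg0 hg1
    set Ψ : (Fin (n + 1) → ℝ) → ℝ := fun z => √((F z * (1 - F z)) ^ 2 + c * gradSq F z) with hΨ
    have hΨc : Continuous Ψ := by
      simp only [hΨ]; fun_prop
    have hΨC : ∀ z, |Ψ z| ≤ √(1 + c * ((n + 1 : ℕ) * B ^ 2)) := fun z => by
      rw [abs_of_nonneg (Real.sqrt_nonneg _)]
      apply Real.sqrt_le_sqrt
      have h2 := mul_one_sub_mem (h0 z) (h1 z)
      have h3 := mul_le_mul_of_nonneg_left (gradSq_le hB z) hc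
      nlinarith
    -- The induction hypothesis on the slice at `x` bounds `J (g x)`. The triangle inequality then
    -- merges the slice integrand `a` with `√c ∂₀F`, and the squares recombine into the full
    -- gradient.
    have hstep : ∀ x, √((g x * (1 - g x)) ^ 2 + c * deriv g x ^ 2) ≤
        ∫ y, Ψ (Fin.cons x y) ∂π + n * s := fun x => by
      set Fx : (Fin n → ℝ) → ℝ := fun y => F (Fin.cons x y) with hFxdef
      have hFxc : ContDiff ℝ 1 Fx := hF.comp (by
        rw [contDiff_pi]
        intro j
        refine Fin.cases ?_ (fun k => ?_) j
        · simpa using contDiff_const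
        · simpa using contDiff_apply ℝ ℝ k)
      have hFxg : ∀ y i, fderiv ℝ Fx y (Pi.single i 1) =
          fderiv ℝ F (Fin.cons x y) (Pi.single i.succ 1) := fderiv_comp_cons_right hFd x
      have hih := ih Fx B hFxc (fun y i => by rw [hFxg]; exact hB _ _) (fun y => h0 _)
        (fun y => h1 _)
      set a : (Fin n → ℝ) → ℝ := fun y => √((Fx y * (1 - Fx y)) ^ 2 + c * gradSq Fx y) with ha
      have hgxc := continuous_gradSq hFxc
      have hac : Continuous a := by
        have := hFxc.continuous
        simp only [ha]; fun_prop
      have haC : ∀ z, |a z| ≤ √(1 + c * (n * B ^ 2)) := fun z => by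
        rw [abs_of_nonneg (Real.sqrt_nonneg _)]
        apply Real.sqrt_le_sqrt
        have h2 := mul_one_sub_mem (h0 (Fin.cons x z)) (h1 (Fin.cons x z))
        have h3 := mul_le_mul_of_nonneg_left (gradSq_le (F := Fx) (B := B)
          (fun y i => by rw [hFxg]; exact hB _ _) z) hc
        simp only [hFxdef]
        nlinarith
      have hmink := sqrt_sq_add_sq_integral_le (hint hac _ haC) ((hpx x).const_mul √c)
      have hgx := (mul_one_sub_mem (hg0 x) (hg1 x)).1
      calc √((g x * (1 - g x)) ^ 2 + c * deriv g x ^ 2)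
          ≤ √((∫ y, a y ∂π + n * s) ^ 2 + c * deriv g x ^ 2) :=
            Real.sqrt_le_sqrt (add_le_add_left (pow_le_pow_left₀ hgx hih 2) _)
        _ ≤ √((∫ y, a y ∂π) ^ 2 + c * deriv g x ^ 2) + n * s :=
            sqrt_add_sq_add_le (integral_nonneg fun y => Real.sqrt_nonneg _) (by positivity)
              (by positivity)
        _ ≤ _ := by
            refine add_le_add_left ?_ _
            rw [integral_const_mul, ← (hgd x).deriv, mul_pow, Real.sq_sqrt hc] at hmink
            refine hmink.trans_eq (integral_congr_ae (ae_of_all _ fun y => ?_))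
            simp only [ha, hΨ]
            rw [Real.sq_sqrt (by have := gradSq_nonneg Fx y; positivity), mul_pow √c,
              Real.sq_sqrt hc]
            congr 1
            simp only [gradSq, hFxg, Fin.sum_univ_succ]
            ring
    have hΨs : ∀ x, Integrable (fun y => Ψ (Fin.cons x y)) π := fun x =>
      hint (hΨc.comp (continuous_cons x)) _ fun y => hΨC _
    have hΨm : Integrable (fun x => ∫ y, Ψ (Fin.cons x y) ∂π) μ := by
      refine Integrable.of_bound (C := √(1 + c * ((n + 1 : ℕ) * B ^ 2))) ?_
        (ae_of_all _ fun x => ?_)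
      · have hc2 : Continuous fun p : ℝ × (Fin n → ℝ) => Ψ (Fin.cons p.1 p.2) :=
          hΨc.comp (by fun_prop)
        exact (hc2.stronglyMeasurable.integral_prod_right').aestronglyMeasurable
      · have := norm_integral_le_of_norm_le_const (μ := π)
          (f := fun y => Ψ (Fin.cons x y)) (ae_of_all _ fun y => hΨC _)
        simpa using this
    rw [integral_pi_succ hFc (C := 1) fun x => by rw [abs_of_nonneg (h0 _)]; exact h1 _,
      integral_pi_succ hΨc hΨC]
    refine h1d.trans ?_
    have h2 : ∫ x, √((g x * (1 - g x)) ^ 2 + c * deriv g x ^ 2) ∂μ ≤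
        ∫ x, (∫ y, Ψ (Fin.cons x y) ∂π + n * s) ∂μ := by
      refine integral_mono ?_ (hΨm.add (integrable_const _)) hstep
      refine Integrable.of_bound (C := √(1 + c * B ^ 2))
        (measurable_sqrt_integrand hgdiff.continuous.measurable c).aestronglyMeasurable
        (ae_of_all _ fun x => ?_)
      rw [Real.norm_of_nonneg (Real.sqrt_nonneg _)]
      exact sqrt_integrand_le hc hgB hg0 hg1 x
    rw [integral_add hΨm (integrable_const _), integral_const, probReal_univ, one_smul] at h2
    push_cast
    linarith

lemma sum_sq_apply_single {n : ℕ} (l : EuclideanSpace ℝ (Fin n) →L[ℝ] ℝ) :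
    ∑ i, l (EuclideanSpace.single i 1) ^ 2 = ‖l‖ ^ 2 := by
  set w := (InnerProductSpace.toDual ℝ (EuclideanSpace ℝ (Fin n))).symm l with hw
  have h1 : ‖w‖ = ‖l‖ := LinearIsometryEquiv.norm_map _ _
  have h2 : ∀ v, l v = inner ℝ w v := fun v => by
    rw [hw, InnerProductSpace.toDual_symm_apply]
  rw [← h1, EuclideanSpace.real_norm_sq_eq]
  refine Finset.sum_congr rfl fun i _ => ?_
  rw [h2, EuclideanSpace.inner_single_right]
  simp

lemma isProbabilityMeasure_prodMeasure (μ : Measure ℝ) [IsProbabilityMeasure μ] (n : ℕ) :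
    IsProbabilityMeasure (prodMeasure μ n) :=
  Measure.isProbabilityMeasure_map (MeasurableEquiv.measurable _).aemeasurable

/-- `Fin n → ℝ` carries the sup norm, which is why the tensorization uses `gradSq`; on
`EuclideanSpace` that quantity is the squared operator norm of the differential. -/
lemma functional_ineq_prodMeasure {μ : Measure ℝ} [IsProbabilityMeasure μ] {c s : ℝ} (hc : 0 ≤ c)
    (hs : 0 ≤ s)
    (H : ∀ (f : ℝ → ℝ) (B : ℝ), Differentiable ℝ f → (∀ x, |deriv f x| ≤ B) → (∀ x, 0 ≤ f x) →
      (∀ x, f x ≤ 1) → (∫ x, f x ∂μ) * (1 - ∫ x, f x ∂μ) ≤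
        ∫ x, √((f x * (1 - f x)) ^ 2 + c * deriv f x ^ 2) ∂μ + s) (n : ℕ)
    {f : EuclideanSpace ℝ (Fin n) → ℝ} {B : ℝ} (hf : ContDiff ℝ 1 f)
    (hB : ∀ x, ‖fderiv ℝ f x‖ ≤ B) (h0 : ∀ x, 0 ≤ f x) (h1 : ∀ x, f x ≤ 1) :
    (∫ x, f x ∂(prodMeasure μ n)) * (1 - ∫ x, f x ∂(prodMeasure μ n)) ≤
      ∫ x, √((f x * (1 - f x)) ^ 2 + c * ‖fderiv ℝ f x‖ ^ 2) ∂(prodMeasure μ n) + n * s := by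
  set e := (EuclideanSpace.equiv (Fin n) ℝ).symm with he
  have hee : ∀ x, MeasurableEquiv.toLp 2 (Fin n → ℝ) x = e x := fun x => rfl
  have hd : ∀ x i, fderiv ℝ (f ∘ e) x (Pi.single i 1) =
      fderiv ℝ f (e x) (EuclideanSpace.single i 1) := fun x i => by
    rw [e.comp_right_fderiv]
    rfl
  have hg : ∀ x, gradSq (f ∘ e) x = ‖fderiv ℝ f (e x)‖ ^ 2 := fun x => by
    simp only [gradSq, hd]
    exact sum_sq_apply_single _
  have hF := functional_ineq_pi hc hs H n (f ∘ e) B (hf.comp e.contDiff)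
    (fun x i => by
      rw [hd]
      refine ((fderiv ℝ f (e x)).le_opNorm _).trans ?_
      simpa using hB (e x)) (fun x => h0 _) (fun x => h1 _)
  simp only [hg, Function.comp_apply] at hF
  simpa only [prodMeasure, integral_map_equiv, hee] using hF

/-! ### From functional inequalities to enlargements -/

/-- A smooth function equal to `1` on `A`, to `0` away from the `h`-enlargement of `A`, with slope
at most `2 / h`. -/
lemma exists_contDiff_cutoff {E : Type*} [NormedAddCommGroup E] [NormedSpace ℝ E]
    [FiniteDimensional ℝ E] {A : Set E} (hA : A.Nonempty) {h : ℝ} (hh : 0 < h) :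
    ∃ f : E → ℝ, ContDiff ℝ 1 f ∧ (∀ x, 0 ≤ f x) ∧ (∀ x, f x ≤ 1) ∧ (∀ x ∈ A, f x = 1) ∧
      (∀ x ∉ Metric.cthickening h A, f x = 0) ∧ ∀ x, ‖fderiv ℝ f x‖ ≤ 2 / h := by
  borelize E
  set vol : Measure E := Measure.addHaar
  set D : E → ℝ := fun x => Metric.infDist x A with hD
  have hDl : LipschitzWith 1 D := Metric.lipschitz_infDist_pt A
  have hDab : ∀ x y, |D x - D y| ≤ dist x y := fun x y => by
    simpa [Real.dist_eq] using hDl.dist_le_mul x y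
  -- This profile is `1` where `D ≤ h / 4` and `0` where `D ≥ 3h / 4`. Mollifying at radius `h / 4`
  -- thus keeps the exact values on `A` and off the enlargement.
  set u : E → ℝ := fun x => max 0 (min 1 (3 / 2 - 2 / h * D x)) with hu
  have huc : Continuous u := by
    have := hDl.continuous
    simp only [hu]; fun_prop
  have hu0 : ∀ x, 0 ≤ u x := fun x => le_max_left _ _
  have hu1 : ∀ x, u x ≤ 1 := fun x => max_le zero_le_one (min_le_left _ _)
  have hul : ∀ x y, |u x - u y| ≤ 2 / h * dist x y := fun x y => by
    calc |u x - u y| ≤ |min 1 (3 / 2 - 2 / h * D x) - min 1 (3 / 2 - 2 / h * D y)| := by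
          simpa [hu] using abs_max_sub_max_le_max 0 (min 1 (3 / 2 - 2 / h * D x)) 0
            (min 1 (3 / 2 - 2 / h * D y))
      _ ≤ |(3 / 2 - 2 / h * D x) - (3 / 2 - 2 / h * D y)| := by
          simpa using abs_min_sub_min_le_max 1 (3 / 2 - 2 / h * D x) 1 (3 / 2 - 2 / h * D y)
      _ = 2 / h * |D x - D y| := by
          rw [← abs_of_pos (show 0 < 2 / h by positivity), ← abs_mul, ← abs_neg,
            abs_of_pos (show 0 < 2 / h by positivity)]
          congr 1; ring
      _ ≤ _ := mul_le_mul_of_nonneg_left (hDab x y) (by positivity)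
  set φ : ContDiffBump (0 : E) := ⟨h / 8, h / 4, by positivity, by linarith⟩
  have hφ1 : ∫ t, φ.normed vol t ∂vol = 1 := φ.integral_normed
  have hφi : Integrable (φ.normed vol) vol := φ.integrable_normed
  have hφ0 : ∀ t, 0 ≤ φ.normed vol t := φ.nonneg_normed
  set f : E → ℝ := convolution (φ.normed vol) u (ContinuousLinearMap.lsmul ℝ ℝ) vol with hf
  have hfx : ∀ x, f x = ∫ t, φ.normed vol t * u (x - t) ∂vol := fun x => rfl
  have hi : ∀ x, Integrable (fun t => φ.normed vol t * u (x - t)) vol := fun x => by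
    refine hφi.mul_bdd (c := 1) (by fun_prop) (ae_of_all _ fun t => ?_)
    rw [Real.norm_of_nonneg (hu0 _)]; exact hu1 _
  have hball : ∀ x (r : ℝ), (∀ y, dist y x < h / 4 → u y = r) → f x = r := fun x r hr => by
    have hx : u x = r := hr x (by rw [dist_self]; positivity)
    rw [hf, φ.normed_convolution_eq_right (fun y hy => ?_), hx]
    rw [hx]; exact hr y hy
  refine ⟨f, ?_, ?_, ?_, ?_, ?_, ?_⟩
  · exact φ.hasCompactSupport_normed.contDiff_convolution_left _ φ.contDiff_normed
      huc.locallyIntegrable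
  · exact fun x => integral_nonneg fun t => mul_nonneg (hφ0 t) (hu0 _)
  · intro x
    rw [hfx, ← hφ1]
    exact integral_mono (hi x) hφi fun t => mul_le_of_le_one_right (hφ0 t) (hu1 _)
  · intro x hx
    refine hball x 1 fun y hy => ?_
    have h1 : D y ≤ dist y x := Metric.infDist_le_dist_of_mem hx
    have h2 : 2 / h * D y ≤ 1 / 2 := by
      rw [div_mul_eq_mul_div, div_le_iff₀ hh]; linarith
    simp only [hu]
    rw [min_eq_left (by linarith), max_eq_right zero_le_one]
  · intro x hx
    refine hball x 0 fun y hy => ?_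
    have h1 : h < D x := by
      by_contra! hlt
      exact hx (by
        rw [Metric.mem_cthickening_iff]
        exact (ENNReal.le_ofReal_iff_toReal_le (Metric.infEDist_ne_top hA) hh.le).2 hlt)
    have h2 := (abs_le.1 (hDab y x)).1
    have h3 : 3 / 2 ≤ 2 / h * D y := by
      rw [div_mul_eq_mul_div, le_div_iff₀ hh]; linarith
    simp only [hu]
    exact max_eq_left ((min_le_right _ _).trans (by linarith))
  · intro x
    have hlip : LipschitzWith (2 / h).toNNReal f := by
      refine LipschitzWith.of_dist_le_mul fun x y => ?_
      rw [Real.coe_toNNReal _ (by positivity), Real.dist_eq, hfx, hfx, ← integral_sub (hi x) (hi y)]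
      calc |∫ t, (φ.normed vol t * u (x - t) - φ.normed vol t * u (y - t)) ∂vol|
          ≤ ∫ t, φ.normed vol t * (2 / h * dist x y) ∂vol := by
            refine (norm_integral_le_integral_norm _).trans
              (integral_mono ((hi x).sub (hi y)).norm (hφi.mul_const _) fun t => ?_)
            simp only []
            rw [Pi.sub_apply, ← mul_sub, norm_mul, Real.norm_of_nonneg (hφ0 t)]
            refine mul_le_mul_of_nonneg_left ?_ (hφ0 t)
            simpa using hul (x - t) (y - t)
        _ = 2 / h * dist x y := by rw [integral_mul_const, hφ1, one_mul]
    have := norm_fderiv_le_of_lipschitz ℝ hlip (x₀ := x)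
    rwa [Real.coe_toNNReal _ (by positivity)] at this

/-- Functional inequalities imply lower bounds for the measure of enlargements. -/
lemma mul_one_sub_le_measure_cthickening {E : Type*} [NormedAddCommGroup E] [NormedSpace ℝ E]
    [FiniteDimensional ℝ E] [MeasurableSpace E] [BorelSpace E] {ν : Measure E}
    [IsProbabilityMeasure ν] {c δ : ℝ} (hc : 0 ≤ c)
    (H : ∀ (f : E → ℝ) (B : ℝ), ContDiff ℝ 1 f → (∀ x, ‖fderiv ℝ f x‖ ≤ B) → (∀ x, 0 ≤ f x) →
      (∀ x, f x ≤ 1) → (∫ x, f x ∂ν) * (1 - ∫ x, f x ∂ν) ≤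
        ∫ x, √((f x * (1 - f x)) ^ 2 + c * ‖fderiv ℝ f x‖ ^ 2) ∂ν + δ)
    {A : Set E} (hA : A.Nonempty) (hAm : MeasurableSet A) {h : ℝ} (hh : 0 < h) :
    ν.real A * (1 - ν.real A) ≤
      (5 / 4 + √c * (2 / h)) * ν.real (Metric.cthickening h A \ A) + δ := by
  obtain ⟨f, hf, h0, h1, hfA, hfh, hfd⟩ := exists_contDiff_cutoff hA hh
  set S := Metric.cthickening h A \ A with hS
  have hSm : MeasurableSet S := Metric.isClosed_cthickening.measurableSet.diff hAm
  have hfi : Integrable f ν := Integrable.of_bound hf.continuous.aestronglyMeasurable 1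
    (ae_of_all _ fun x => by rw [Real.norm_of_nonneg (h0 x)]; exact h1 x)
  have hlow : ν.real A ≤ ∫ x, f x ∂ν := by
    rw [← integral_indicator_one hAm]
    refine integral_mono ((integrable_const 1).indicator hAm) hfi fun x => ?_
    by_cases hx : x ∈ A
    · simp [hx, hfA x hx]
    · simpa [hx] using h0 x
  have hupp : ∫ x, f x ∂ν ≤ ν.real A + ν.real S := by
    rw [← integral_indicator_one hAm, ← integral_indicator_one hSm,
      ← integral_add ((integrable_const 1).indicator hAm) ((integrable_const 1).indicator hSm)]
    refine integral_mono hfi (((integrable_const 1).indicator hAm).add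
      ((integrable_const 1).indicator hSm)) fun x => ?_
    by_cases hx : x ∈ A
    · simp [hx, hfA x hx, hS]
    · by_cases hx' : x ∈ Metric.cthickening h A
      · simpa [hx, hx', hS] using h1 x
      · simp [hx, hx', hS, hfh x hx']
  -- Off `S`, `f` takes an extreme value `1` or `0`, so its differential vanishes there with no
  -- regularity of `A`.
  have hgrad : ∀ x ∉ S, f x * (1 - f x) = 0 ∧ fderiv ℝ f x = 0 := fun x hx => by
    by_cases hxA : x ∈ A
    · refine ⟨by simp [hfA x hxA], IsLocalMax.fderiv_eq_zero (Eventually.of_forall fun y => ?_)⟩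
      rw [hfA x hxA]; exact h1 y
    · have hx' : x ∉ Metric.cthickening h A := fun h => hx ⟨h, hxA⟩
      refine ⟨by simp [hfh x hx'], IsLocalMin.fderiv_eq_zero (Eventually.of_forall fun y => ?_)⟩
      rw [hfh x hx']; exact h0 y
  have hbound : ∀ x, √((f x * (1 - f x)) ^ 2 + c * ‖fderiv ℝ f x‖ ^ 2) ≤
      S.indicator (fun _ => 1 / 4 + √c * (2 / h)) x := fun x => by
    by_cases hx : x ∈ S
    · rw [indicator_of_mem hx, Real.sqrt_le_left (by positivity)]
      have e1 := mul_one_sub_mem (h0 x) (h1 x)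
      have e2 : c * ‖fderiv ℝ f x‖ ^ 2 ≤ (√c * (2 / h)) ^ 2 := by
        rw [mul_pow √c, Real.sq_sqrt hc]
        exact mul_le_mul_of_nonneg_left (pow_le_pow_left₀ (norm_nonneg _) (hfd x) 2) hc
      have e3 : 0 ≤ √c * (2 / h) := by positivity
      nlinarith
    · rw [indicator_of_notMem hx, (hgrad x hx).1, (hgrad x hx).2]
      simp
  have hint : ∫ x, √((f x * (1 - f x)) ^ 2 + c * ‖fderiv ℝ f x‖ ^ 2) ∂ν ≤
      (1 / 4 + √c * (2 / h)) * ν.real S := by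
    calc _ ≤ ∫ x, S.indicator (fun _ => 1 / 4 + √c * (2 / h)) x ∂ν :=
          integral_mono_of_nonneg (ae_of_all _ fun x => Real.sqrt_nonneg _)
            ((integrable_const _).indicator hSm) (ae_of_all _ hbound)
      _ = _ := by rw [integral_indicator_const _ hSm, smul_eq_mul, mul_comm]
  have hmain := H f (2 / h) hf hfd h0 h1
  have hp1 : ∫ x, f x ∂ν ≤ 1 := by
    calc ∫ x, f x ∂ν ≤ ∫ _, (1 : ℝ) ∂ν := integral_mono hfi (integrable_const _) h1
      _ = 1 := by simp
  -- Replacing `J (∫ f)` by `J (ν A)` costs at most `∫ f - ν A ≤ ν S`, which turns `1 / 4` into `5 /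
  -- 4`.
  have hA0 : 0 ≤ ν.real A := measureReal_nonneg
  nlinarith [mul_nonneg (sub_nonneg.2 hlow) (sub_nonneg.2 hp1),
    mul_nonneg (sub_nonneg.2 hlow) hA0]

/-! ### Growth of `Φ`, tails and chords -/

lemma continuousOn_of_concaveOn_Ici {Φ : ℝ → ℝ} (hconc : ConcaveOn ℝ (Ici 0) Φ)
    (hcont : ContinuousWithinAt Φ (Ici 0) 0) : ContinuousOn Φ (Ici 0) := by
  intro x hx
  rcases (mem_Ici.1 hx).eq_or_lt with rfl | hx0
  · exact hcont
  · have h := hconc.continuousOn_interior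
    rw [interior_Ici] at h
    exact (h.continuousAt (Ioi_mem_nhds hx0)).continuousWithinAt

lemma continuous_comp_abs {Φ : ℝ → ℝ} (hΦ : ContinuousOn Φ (Ici 0)) :
    Continuous fun x : ℝ => Φ |x| :=
  hΦ.comp_continuous continuous_abs fun x => abs_nonneg x

lemma exists_lt_of_integrable_exp_neg {Φ : ℝ → ℝ}
    (hint : Integrable fun x : ℝ => Real.exp (-Φ |x|)) (B : ℝ) : ∃ x, 0 ≤ x ∧ B < Φ x := by
  by_contra! h
  have h1 : Integrable (fun _ : ℝ => Real.exp (-B)) := by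
    refine hint.mono' aestronglyMeasurable_const (ae_of_all _ fun x => ?_)
    rw [Real.norm_of_nonneg (Real.exp_nonneg _)]
    exact Real.exp_le_exp.2 (neg_le_neg (h _ (abs_nonneg x)))
  rw [integrable_const_iff] at h1
  rcases h1 with h1 | h1
  · exact (Real.exp_pos _).ne' h1
  · simpa using h1.measure_univ_lt_top

/-- Secants of the convex function `Φ ^ θ` from a base point `r` have nondecreasing slope, so `Φ (k
x) ^ θ ≥ (k / 2) Φ x ^ θ` once `Φ x ≥ 2 Φ r`; then `k ≥ 2 * 2 ^ θ` suffices. For `δ ≤ x ≤ X`,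
monotonicity and `k δ ≥ Y` suffice. All `k ≥ l` are covered so that `l` can be enlarged later. -/
lemma exists_forall_two_mul_le {Φ : ℝ → ℝ} (hmono : MonotoneOn Φ (Ici 0))
    (hunb : ∀ B, ∃ x, 0 ≤ x ∧ B < Φ x) {θ R : ℝ} (hθ : 1 < θ) (hR : 0 ≤ R)
    (hconv : ConvexOn ℝ (Ioi R) fun x => Φ x ^ θ) {δ : ℝ} (hδ : 0 < δ) :
    ∃ l : ℝ, 1 < l ∧ ∀ k, l ≤ k → ∀ x, δ ≤ x → 2 * Φ x ≤ Φ (k * x) := by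
  obtain ⟨r₀, hr₀, hr₀'⟩ := hunb 0
  set r := max r₀ (R + 1) with hr
  have hrR : R < r := by linarith [le_max_right r₀ (R + 1)]
  have hr0 : 0 < r := by linarith
  have hΦr : 0 < Φ r := hr₀'.trans_le (hmono hr₀ hr0.le (le_max_left _ _))
  obtain ⟨X, hX, hX'⟩ := hunb (2 * Φ r)
  have hrX : r < X := by
    by_contra! h
    linarith [hmono hX hr0.le h]
  obtain ⟨Y, hY, hY'⟩ := hunb (2 * Φ X)
  refine ⟨max (2 * 2 ^ θ) (Y / δ) + 1, ?_, fun k hk x hx => ?_⟩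
  · have : (0 : ℝ) < 2 * 2 ^ θ := by positivity
    linarith [le_max_left (2 * 2 ^ θ) (Y / δ)]
  have hk1 : 2 * 2 ^ θ ≤ k := by linarith [le_max_left (2 * 2 ^ θ) (Y / δ)]
  have hk2 : Y / δ ≤ k := by linarith [le_max_right (2 * 2 ^ θ) (Y / δ)]
  have h2θ : (2 : ℝ) ≤ 2 ^ θ := by
    simpa using Real.rpow_le_rpow_of_exponent_le (x := 2) (by norm_num) hθ.le
  have hkpos : 0 < k := by linarith
  have hx0 : 0 ≤ x := hδ.le.trans hx
  rcases le_total x X with hxX | hXx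
  · have h1 : Y ≤ k * x := by
      rw [div_le_iff₀ hδ] at hk2
      exact hk2.trans (mul_le_mul_of_nonneg_left hx hkpos.le)
    linarith [hmono hx0 hX hxX, hmono hY (mem_Ici.2 (hY.trans h1)) h1]
  · have hrx : r < x := hrX.trans_le hXx
    have hxk : x ≤ k * x := by nlinarith
    have hΦx : 2 * Φ r ≤ Φ x := by linarith [hmono hX hx0 hXx]
    have hΦx0 : 0 < Φ x := by linarith
    have hΦk : 0 < Φ (k * x) := hΦx0.trans_le (hmono hx0 (mem_Ici.2 (hx0.trans hxk)) hxk)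
    have hψ : 2 * Φ r ^ θ ≤ Φ x ^ θ := by
      calc 2 * Φ r ^ θ ≤ 2 ^ θ * Φ r ^ θ :=
            mul_le_mul_of_nonneg_right h2θ (Real.rpow_nonneg hΦr.le _)
        _ = (2 * Φ r) ^ θ := (Real.mul_rpow (by norm_num) hΦr.le).symm
        _ ≤ Φ x ^ θ := Real.rpow_le_rpow (by positivity) hΦx (by linarith)
    have hsec := hconv.secant_mono (a := r) (x := x) (y := k * x) hrR (hrR.trans hrx)
      (hrR.trans (hrx.trans_le hxk)) hrx.ne' (hrx.trans_le hxk).ne' hxk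
    have hψx : 0 ≤ Φ x ^ θ := Real.rpow_nonneg hΦx0.le _
    have hψr : 0 ≤ Φ r ^ θ := Real.rpow_nonneg hΦr.le _
    rw [div_le_div_iff₀ (by linarith) (by linarith)] at hsec
    have hgrow : k / 2 * Φ x ^ θ ≤ Φ (k * x) ^ θ := by
      have h1 : k * (x - r) ≤ k * x - r := by nlinarith
      have h2 : (Φ x ^ θ / 2) * (k * (x - r)) ≤ (Φ x ^ θ - Φ r ^ θ) * (k * x - r) :=
        mul_le_mul (by linarith) h1 (by have : 0 < x - r := by linarith
                                        positivity) (by linarith)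
      have h3 : (k / 2 * Φ x ^ θ) * (x - r) ≤ (Φ (k * x) ^ θ - Φ r ^ θ) * (x - r) := by
        linarith
      linarith [le_of_mul_le_mul_right h3 (by linarith)]
    rw [← Real.rpow_le_rpow_iff (by positivity) hΦk.le (show 0 < θ by linarith),
      Real.mul_rpow (by norm_num) hΦx0.le]
    exact (mul_le_mul_of_nonneg_right (by linarith) hψx).trans hgrow

/-- For large `|x|`, doubling gives `exp (-Φ |x| / 2) ≤ exp (-Φ |x / l|)`, a dilate of the original
integrable function. -/
lemma integrable_exp_neg_half {Φ : ℝ → ℝ} (hmono : MonotoneOn Φ (Ici 0))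
    (hc : Continuous fun x : ℝ => Φ |x|) (hint : Integrable fun x : ℝ => Real.exp (-Φ |x|))
    {δ l : ℝ} (hδ : 0 < δ) (hl : 0 < l) (h2 : ∀ x, δ ≤ x → 2 * Φ x ≤ Φ (l * x)) :
    Integrable fun x : ℝ => Real.exp (-Φ |x| / 2) := by
  have h1 := (hint.comp_div hl.ne').const_mul (1 + Real.exp (Φ δ - Φ 0 / 2))
  refine h1.mono' (hc.neg.div_const 2).rexp.aestronglyMeasurable (ae_of_all _ fun x => ?_)
  rw [Real.norm_of_nonneg (Real.exp_nonneg _)]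
  have hxl : |x / l| = |x| / l := by rw [abs_div, abs_of_pos hl]
  have hp := Real.exp_pos (Φ δ - Φ 0 / 2)
  have hp' := Real.exp_pos (-Φ |x / l|)
  rcases le_total δ |x / l| with h | h
  · have h3 := h2 _ h
    rw [hxl, mul_div_cancel₀ _ hl.ne', ← hxl] at h3
    calc Real.exp (-Φ |x| / 2) ≤ Real.exp (-Φ |x / l|) := Real.exp_le_exp.2 (by linarith)
      _ ≤ _ := by nlinarith
  · have h3 := hmono (mem_Ici.2 (abs_nonneg (x / l))) hδ.le h
    have h4 := hmono (mem_Ici.2 le_rfl) (mem_Ici.2 (abs_nonneg x)) (abs_nonneg x)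
    calc Real.exp (-Φ |x| / 2) ≤ Real.exp (Φ δ - Φ 0 / 2) * Real.exp (-Φ |x / l|) := by
          rw [← Real.exp_add]; exact Real.exp_le_exp.2 (by linarith)
      _ ≤ _ := by nlinarith

lemma exists_forall_setIntegral_compl_le {u : ℝ → ℝ} (hu : Integrable u) {ε : ℝ} (hε : 0 < ε) :
    ∃ M₀ : ℝ, 0 < M₀ ∧ ∀ M, M₀ ≤ M → ∫ x in (Ioc (-M) M)ᶜ, u x ≤ ε := by
  have ht := intervalIntegral_tendsto_integral hu tendsto_neg_atTop_atBot tendsto_id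
  have hev := (ht.eventually (lt_mem_nhds (sub_lt_self (∫ x, u x) hε)))
  obtain ⟨a, ha⟩ := eventually_atTop.1 hev
  refine ⟨max a 1, by positivity, fun M hM => ?_⟩
  have h1 := ha M ((le_max_left _ _).trans hM)
  have hM1 : 1 ≤ M := (le_max_right _ _).trans hM
  simp only [id] at h1
  rw [intervalIntegral.integral_of_le (by linarith)] at h1
  have h2 := integral_add_compl (measurableSet_Ioc (a := -M) (b := M)) hu
  linarith

lemma rightDeriv_le_of_concaveOn {Φ : ℝ → ℝ} (hmono : MonotoneOn Φ (Ici 0))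
    (hconc : ConcaveOn ℝ (Ici 0) Φ) {x : ℝ} (hx : 0 < x) :
    rightDeriv Φ x ≤ (Φ x - Φ 0) / x := by
  by_cases hd : DifferentiableWithinAt ℝ Φ (Ioi x) x
  · have ht := (hasDerivWithinAt_iff_tendsto_slope' (by simp)).1 hd.hasDerivWithinAt
    refine le_of_tendsto ht ?_
    filter_upwards [self_mem_nhdsWithin] with y hy
    have hy' : x < y := hy
    have := hconc.slope_anti_adjacent (mem_Ici.2 le_rfl) (mem_Ici.2 (hx.trans hy').le) hx hy'
    rw [slope_def_field]
    simpa using this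
  -- Here the derivative has its default value `0`, and monotonicity suffices.
  · rw [rightDeriv, derivWithin_zero_of_not_differentiableWithinAt hd]
    exact div_nonneg (sub_nonneg.2 (hmono (mem_Ici.2 le_rfl) hx.le hx.le)) hx.le

/-- Chords of a concave function flatten to the right, so on `[0, M]` the growth rate is at least
the slope over `[M, N]`. This replaces a derivative of `Φ` at `M`. -/
lemma add_slope_mul_le_of_concaveOn {Φ : ℝ → ℝ} (hconc : ConcaveOn ℝ (Ici 0) Φ) {x y M N : ℝ}
    (hx : 0 ≤ x) (hxy : x ≤ y) (hyM : y ≤ M) (hMN : M < N) :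
    Φ x + (Φ N - Φ M) / (N - M) * (y - x) ≤ Φ y := by
  rcases hxy.eq_or_lt with rfl | hxy
  · simp
  have hN : (0 : ℝ) ≤ N := by linarith
  have h1 := hconc.slope_anti_adjacent hx hN hxy (hyM.trans_lt hMN)
  have h2 := hconc.neg.secant_mono (a := N) (x := y) (y := M) hN (mem_Ici.2 (by linarith))
    (mem_Ici.2 (by linarith)) (by linarith) (by linarith) hyM
  simp only [Pi.neg_apply] at h2
  have e1 : (-Φ y - -Φ N) / (y - N) = -((Φ N - Φ y) / (N - y)) := by
    rw [← neg_sub N y, div_neg]; congr 2; ring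
  have e2 : (-Φ M - -Φ N) / (M - N) = -((Φ N - Φ M) / (N - M)) := by
    rw [← neg_sub N M, div_neg]; congr 2; ring
  rw [e1, e2] at h2
  have h3 : (Φ N - Φ M) / (N - M) ≤ (Φ y - Φ x) / (y - x) := by linarith
  rw [le_div_iff₀ (by linarith)] at h3
  linarith

lemma integral_exp_neg_le {Φ : ℝ → ℝ} (hc : Continuous fun x : ℝ => Φ |x|) {x M σ : ℝ}
    (hσ : 0 < σ) (hx : 0 ≤ x) (hxM : x ≤ M)
    (h : ∀ y ∈ Icc x M, Φ x + σ * (y - x) ≤ Φ y) :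
    ∫ y in x..M, Real.exp (-Φ |y|) ≤ σ⁻¹ * Real.exp (-Φ |x|) := by
  have hd : ∀ y, HasDerivAt (fun y => -σ⁻¹ * (Real.exp (-Φ x) * Real.exp (-σ * (y - x))))
      (Real.exp (-Φ x) * Real.exp (-σ * (y - x))) y := fun y => by
    have h1 := ((((hasDerivAt_id' y).sub_const x).const_mul (-σ)).exp.const_mul
      (Real.exp (-Φ x))).const_mul (-σ⁻¹)
    refine h1.congr_deriv ?_
    field_simp
  have hcont : Continuous fun y => Real.exp (-Φ x) * Real.exp (-σ * (y - x)) := by fun_prop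
  have hI := intervalIntegral.integral_eq_sub_of_hasDerivAt (a := x) (b := M)
    (fun y _ => hd y) (hcont.intervalIntegrable _ _)
  rw [abs_of_nonneg hx]
  calc ∫ y in x..M, Real.exp (-Φ |y|)
      ≤ ∫ y in x..M, Real.exp (-Φ x) * Real.exp (-σ * (y - x)) := by
        refine intervalIntegral.integral_mono_on hxM (hc.neg.rexp.intervalIntegrable _ _)
          (hcont.intervalIntegrable _ _) fun y hy => ?_
        rw [← Real.exp_add, abs_of_nonneg (hx.trans hy.1)]
        exact Real.exp_le_exp.2 (by linarith [h y hy])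
    _ = σ⁻¹ * Real.exp (-Φ x) -
        σ⁻¹ * (Real.exp (-Φ x) * Real.exp (-σ * (M - x))) := by
        rw [hI]; simp; ring
    _ ≤ _ := sub_le_self _ (by positivity)

lemma integral_exp_neg_pos {Φ : ℝ → ℝ} (hint : Integrable fun x : ℝ => Real.exp (-Φ |x|)) :
    0 < ∫ x : ℝ, Real.exp (-Φ |x|) := by
  rw [integral_pos_iff_support_of_nonneg (fun x => (Real.exp_pos _).le) hint]
  have : (Function.support fun x : ℝ => Real.exp (-Φ |x|)) = univ :=
    eq_univ_of_forall fun x => (Real.exp_pos _).ne'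
  simp [this]

lemma isProbabilityMeasure_muPhi {Φ : ℝ → ℝ}
    (hint : Integrable fun x : ℝ => Real.exp (-Φ |x|)) : IsProbabilityMeasure (muPhi Φ) := by
  have hZ := integral_exp_neg_pos hint
  refine ⟨?_⟩
  rw [muPhi, withDensity_apply _ MeasurableSet.univ, Measure.restrict_univ,
    ← ofReal_integral_eq_lintegral_ofReal (hint.const_mul _)
      (ae_of_all _ fun x => by positivity), integral_const_mul, inv_mul_cancel₀ hZ.ne',
    ENNReal.ofReal_one]

lemma muPhi_real {Φ : ℝ → ℝ} (hint : Integrable fun x : ℝ => Real.exp (-Φ |x|)) {S : Set ℝ}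
    (hS : MeasurableSet S) :
    (muPhi Φ).real S = (∫ x : ℝ, Real.exp (-Φ |x|))⁻¹ * ∫ x in S, Real.exp (-Φ |x|) := by
  have hZ := integral_exp_neg_pos hint
  rw [measureReal_def, muPhi, withDensity_apply _ hS,
    ← ofReal_integral_eq_lintegral_ofReal (hint.integrableOn.const_mul _)
      (ae_of_all _ fun x => by positivity), integral_const_mul, ENNReal.toReal_ofReal]
  exact mul_nonneg (by positivity) (integral_nonneg fun x => (Real.exp_pos _).le)

/-- At every level `x ≥ δ`, the scale `M = l x` carries a tail of mass at most `exp (-Φ x) / 4`. -/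
lemma exists_doubling_scale {Φ : ℝ → ℝ} (hmono : MonotoneOn Φ (Ici 0))
    (hc : Continuous fun x : ℝ => Φ |x|) (hint : Integrable fun x : ℝ => Real.exp (-Φ |x|))
    {θ R : ℝ} (hθ : 1 < θ) (hR : 0 ≤ R) (hconv : ConvexOn ℝ (Ioi R) fun x => Φ x ^ θ)
    {δ : ℝ} (hδ : 0 < δ) :
    ∃ l : ℝ, 1 < l ∧ (∀ x, δ ≤ x → 2 * Φ x ≤ Φ (l * x)) ∧
      ∀ x, δ ≤ x → (muPhi Φ).real (Ioc (-(l * x)) (l * x))ᶜ ≤ Real.exp (-Φ x) / 4 := by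
  obtain ⟨l₀, hl₀, hdbl⟩ := exists_forall_two_mul_le hmono (exists_lt_of_integrable_exp_neg hint)
    hθ hR hconv hδ
  have hhalf := integrable_exp_neg_half hmono hc hint hδ (by linarith) (hdbl l₀ le_rfl)
  have hZ := integral_exp_neg_pos hint
  set Z := ∫ x : ℝ, Real.exp (-Φ |x|) with hZdef
  obtain ⟨M₀, hM₀, htail⟩ := exists_forall_setIntegral_compl_le hhalf
    (show 0 < Z / 4 by positivity)
  set l := max l₀ (M₀ / δ)
  have hl : 1 < l := hl₀.trans_le (le_max_left _ _)
  have hdl := hdbl l (le_max_left _ _)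
  refine ⟨l, hl, hdl, fun x hx => ?_⟩
  have hx0 : 0 < x := hδ.trans_le hx
  have hM : M₀ ≤ l * x := by
    have h1 : M₀ / δ ≤ l := le_max_right _ _
    rw [div_le_iff₀ hδ] at h1
    exact h1.trans (mul_le_mul_of_nonneg_left hx (by linarith))
  have hlx : 0 < l * x := by positivity
  rw [muPhi_real hint measurableSet_Ioc.compl, ← hZdef]
  -- For `|y| ≥ l x`, half of `Φ |y|` already exceeds `Φ x`; the other half is kept for
  -- integrability.
  have h1 : ∫ y in (Ioc (-(l * x)) (l * x))ᶜ, Real.exp (-Φ |y|) ≤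
      ∫ y in (Ioc (-(l * x)) (l * x))ᶜ, Real.exp (-Φ x) * Real.exp (-Φ |y| / 2) := by
    refine setIntegral_mono_on hint.integrableOn (hhalf.integrableOn.const_mul _)
      measurableSet_Ioc.compl fun y hy => ?_
    have hy' : l * x ≤ |y| := by
      by_contra! h
      exact hy ⟨(abs_lt.1 h).1, (abs_lt.1 h).2.le⟩
    have h2 := hmono hlx.le (mem_Ici.2 (abs_nonneg y)) hy'
    have h3 := hdl x hx
    rw [← Real.exp_add]
    exact Real.exp_le_exp.2 (by linarith)
  rw [integral_const_mul] at h1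
  have h2 := mul_le_mul_of_nonneg_left (htail _ hM) (Real.exp_pos (-Φ x)).le
  calc Z⁻¹ * ∫ y in (Ioc (-(l * x)) (l * x))ᶜ, Real.exp (-Φ |y|)
      ≤ Z⁻¹ * (Real.exp (-Φ x) * (Z / 4)) :=
        mul_le_mul_of_nonneg_left (h1.trans h2) (by positivity)
    _ = _ := by field_simp

/-! ### Isoperimetry at a given scale -/

/-- The weak functional inequality for `muPhi Φ`, with constants given by a chord of `Φ`. -/
lemma functional_ineq_muPhi {Φ : ℝ → ℝ} (hconc : ConcaveOn ℝ (Ici 0) Φ)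
    (hc : Continuous fun x : ℝ => Φ |x|) (hint : Integrable fun x : ℝ => Real.exp (-Φ |x|))
    {M N : ℝ} (hM : 0 ≤ M) (hMN : M < N) (hΦ : Φ M < Φ N)
    {f : ℝ → ℝ} {B : ℝ} (hf : Differentiable ℝ f) (hB : ∀ x, |deriv f x| ≤ B)
    (h0 : ∀ x, 0 ≤ f x) (h1 : ∀ x, f x ≤ 1) :
    (∫ x, f x ∂(muPhi Φ)) * (1 - ∫ x, f x ∂(muPhi Φ)) ≤
      ∫ x, √((f x * (1 - f x)) ^ 2 + 18 * ((Φ N - Φ M) / (N - M))⁻¹ ^ 2 * deriv f x ^ 2)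
        ∂(muPhi Φ) + (muPhi Φ).real (Ioc (-M) M)ᶜ := by
  have := isProbabilityMeasure_muPhi hint
  have hZ := integral_exp_neg_pos hint
  have hσ : 0 < (Φ N - Φ M) / (N - M) := div_pos (by linarith) (by linarith)
  refine functional_ineq_line (μ := muPhi Φ) rfl hM (continuous_const.mul hc.neg.rexp) (fun x => by positivity)
    (fun x => by rw [abs_neg]) (fun x hx => ?_) hf hB h0 h1
  rw [intervalIntegral.integral_const_mul, mul_left_comm]
  refine mul_le_mul_of_nonneg_left (integral_exp_neg_le hc hσ hx.1 hx.2 fun y hy => ?_)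
    (by positivity)
  exact add_slope_mul_le_of_concaveOn hconc hx.1 hy.1 hy.2 hMN

lemma min_div_two_le {t : ℝ} (h0 : 0 ≤ t) (h1 : t ≤ 1) : min t (1 - t) / 2 ≤ t * (1 - t) := by
  rcases le_total t (1 - t) with h | h
  · rw [min_eq_left h]; nlinarith
  · rw [min_eq_right h]; nlinarith

/-- Product isoperimetry in terms of a chord of `Φ` and the mass of a tail. -/
lemma le_isoProfile_of_tail_le {Φ : ℝ → ℝ} (hconc : ConcaveOn ℝ (Ici 0) Φ)
    (hc : Continuous fun x : ℝ => Φ |x|) (hint : Integrable fun x : ℝ => Real.exp (-Φ |x|))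
    {M N : ℝ} (hM : 0 ≤ M) (hMN : M < N) (hΦ : Φ M < Φ N) {n : ℕ} {t : ℝ} (ht0 : 0 < t)
    (ht1 : t < 1) (htail : n * (muPhi Φ).real (Ioc (-M) M)ᶜ ≤ min t (1 - t) / 4) :
    ENNReal.ofReal (min t (1 - t) * ((Φ N - Φ M) / (N - M)) / (13 * √18)) ≤
      isoProfile (prodMeasure (muPhi Φ) n) t := by
  have := isProbabilityMeasure_muPhi hint
  have := isProbabilityMeasure_prodMeasure (muPhi Φ) n
  set σ := (Φ N - Φ M) / (N - M) with hσdef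
  have hσ : 0 < σ := div_pos (by linarith) (by linarith)
  set m := min t (1 - t)
  refine le_sInf ?_
  rintro b ⟨A, hAm, hAt, rfl⟩
  have hA : A.Nonempty := by
    rw [nonempty_iff_ne_empty]
    rintro rfl
    rw [measure_empty, eq_comm, ENNReal.ofReal_eq_zero] at hAt
    linarith
  have hAr : (prodMeasure (muPhi Φ) n).real A = t := by
    rw [measureReal_def, hAt, ENNReal.toReal_ofReal ht0.le]
  have hc0 : (0 : ℝ) ≤ 18 * σ⁻¹ ^ 2 := by positivity
  have hC : √(18 * σ⁻¹ ^ 2) = √18 / σ := by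
    rw [Real.sqrt_mul (by norm_num), Real.sqrt_sq (by positivity), div_eq_mul_inv]
  have hCpos : 0 < √18 / σ := by positivity
  refine le_liminf_of_le (by isBoundedDefault) ?_
  -- For `h < √18 / σ` the term `5 / 4` is absorbed into the one of order `1 / h`, giving the factor
  -- `5 / 4 + 2 = 13 / 4`.
  filter_upwards [Ioo_mem_nhdsGT hCpos] with h hh
  have hineq := mul_one_sub_le_measure_cthickening hc0
    (fun f B hf hB h0 h1 => functional_ineq_prodMeasure hc0 measureReal_nonneg
      (fun f B hf hB h0 h1 => functional_ineq_muPhi hconc hc hint hM hMN hΦ hf hB h0 h1)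
      n hf hB h0 h1) hA hAm hh.1
  rw [hAr, hC] at hineq
  set S := Metric.cthickening h A \ A
  have hS0 : 0 ≤ (prodMeasure (muPhi Φ) n).real S := measureReal_nonneg
  have hm := min_div_two_le ht0.le ht1.le
  have hh0 : 0 < h := hh.1
  have h1 : (1 : ℝ) ≤ √18 / σ / h := by rw [le_div_iff₀ hh0]; linarith [hh.2]
  have h2 : m / 4 ≤ 13 / 4 * (√18 / σ / h) * (prodMeasure (muPhi Φ) n).real S := by
    have h3 : 5 / 4 + √18 / σ * (2 / h) ≤ 13 / 4 * (√18 / σ / h) := by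
      have : √18 / σ * (2 / h) = 2 * (√18 / σ / h) := by ring
      linarith
    have h4 := mul_le_mul_of_nonneg_right h3 hS0
    linarith
  rw [ENNReal.le_div_iff_mul_le (Or.inl (by simpa using hh0)) (Or.inl ENNReal.ofReal_ne_top),
    ← ENNReal.ofReal_mul' hh0.le, ← ofReal_measureReal]
  refine ENNReal.ofReal_le_ofReal ?_
  have h5 : 0 < √18 := by positivity
  calc m * σ / (13 * √18) * h = (m / 4) * (4 * σ * h / (13 * √18)) := by ring
    _ ≤ (13 / 4 * (√18 / σ / h) * (prodMeasure (muPhi Φ) n).real S) *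
        (4 * σ * h / (13 * √18)) := mul_le_mul_of_nonneg_right h2 (by positivity)
    _ = _ := by field_simp

end HeavyTail

/-! ### Choice of the scale -/

theorem mainTheorem3 (Φ : ℝ → ℝ)
    (hmono : MonotoneOn Φ (Set.Ici 0))
    (hconc : ConcaveOn ℝ (Set.Ici 0) Φ)
    (hcont : ContinuousWithinAt Φ (Set.Ici 0) 0)
    (hlim : Filter.Tendsto (fun x : ℝ => Φ x / x) Filter.atTop (nhds 0))
    (hzero : Φ 0 < Real.log 2)
    (hC2 : ∃ R : ℝ, 0 ≤ R ∧ ContDiffOn ℝ 2 Φ (Set.Ioi R))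
    (hconv : ∃ θ : ℝ, 1 < θ ∧ ∃ R : ℝ, 0 ≤ R ∧ ConvexOn ℝ (Set.Ioi R) (fun x : ℝ => Φ x ^ θ))
    (hint : MeasureTheory.Integrable (fun x : ℝ => Real.exp (-Φ |x|))) :
    ∃ c : ℝ, 0 < c ∧ ∀ n : ℕ, 1 ≤ n → ∀ t ∈ Set.Icc (0 : ℝ) 1,
      ENNReal.ofReal (c * min t (1 - t) *
          HeavyTail.rightDeriv Φ (HeavyTail.halfLineInv Φ (Real.log ((n : ℝ) / min t (1 - t)))))
        ≤ HeavyTail.isoProfile (HeavyTail.prodMeasure (HeavyTail.muPhi Φ) n) t := by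
  open HeavyTail in
  obtain ⟨θ, hθ, R, hR, hconv⟩ := hconv
  have hon := continuousOn_of_concaveOn_Ici hconc hcont
  have hc := continuous_comp_abs hon
  -- Since `n / m ≥ 2`, the assumption `Φ 0 < log 2` keeps every relevant `Φ⁻¹ (log (n / m))` above
  -- a fixed `δ`.
  obtain ⟨δ, hδ, hδ2⟩ : ∃ δ : ℝ, 0 < δ ∧ ∀ x, 0 ≤ x → Real.log 2 ≤ Φ x → δ ≤ x := by
    obtain ⟨δ, hδ, h⟩ := Metric.continuousWithinAt_iff.1 hcont (Real.log 2 - Φ 0) (by linarith)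
    refine ⟨δ, hδ, fun x hx hx2 => ?_⟩
    by_contra! hlt
    have h1 := h (mem_Ici.2 hx) (by rwa [Real.dist_eq, sub_zero, abs_of_nonneg hx])
    rw [Real.dist_eq] at h1
    linarith [le_abs_self (Φ x - Φ 0)]
  obtain ⟨l, hl, hdbl, htail⟩ := exists_doubling_scale hmono hc hint hθ hR hconv hδ
  have hlog2 : 0 < Real.log 2 := Real.log_pos one_lt_two
  -- `Φ 0` may be negative; `K` absorbs it through `Φ x - Φ 0 ≤ K Φ x` when `Φ x ≥ log 2`.
  set K := 1 + |Φ 0| / Real.log 2 with hK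
  have hKpos : 0 < K := by positivity
  have hlpos : 0 < l := by linarith
  refine ⟨(K * l ^ 2 * (13 * √18))⁻¹, by positivity, fun n hn t ht => ?_⟩
  have hm0 : 0 ≤ min t (1 - t) := le_min ht.1 (by linarith [ht.2])
  rcases hm0.eq_or_lt with hm | hm
  · rw [← hm]; simp
  have ht0 : 0 < t := hm.trans_le (min_le_left _ _)
  have ht1 : t < 1 := by linarith [min_le_right t (1 - t)]
  set m := min t (1 - t) with hmdef
  have hm2 : m ≤ 1 / 2 := by linarith [min_le_right t (1 - t), min_le_left t (1 - t)]
  have hn1 : (1 : ℝ) ≤ n := by exact_mod_cast hn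
  have hnm : 2 ≤ n / m := by rw [le_div_iff₀ hm]; linarith
  have hlog : Real.log 2 ≤ Real.log (n / m) := Real.log_le_log two_pos hnm
  set x := halfLineInv Φ (Real.log (n / m)) with hx
  have hex : ∃ a ∈ Ici (0 : ℝ), Φ a = Real.log (n / m) := by
    obtain ⟨y, hy, hy'⟩ := exists_lt_of_integrable_exp_neg hint (Real.log (n / m))
    obtain ⟨a, ha, hae⟩ := intermediate_value_Icc hy
      (hon.mono Icc_subset_Ici_self) ⟨(hzero.trans_le hlog).le, hy'.le⟩
    exact ⟨a, ha.1, hae⟩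
  have hx0' : 0 ≤ x := Function.invFunOn_mem hex
  have hΦx : Φ x = Real.log (n / m) := Function.invFunOn_eq hex
  have hδx : δ ≤ x := hδ2 x hx0' (by rw [hΦx]; exact hlog)
  have hx0 : 0 < x := hδ.trans_le hδx
  have hxM : x ≤ l * x := by nlinarith
  have hMpos : 0 < l * x := by positivity
  have hMN : l * x < l * (l * x) := by nlinarith
  have hΦM := hdbl x hδx
  have hΦN := hdbl (l * x) (hδx.trans hxM)
  have hΦx2 : Real.log 2 ≤ Φ x := by rw [hΦx]; exact hlog
  have hexp : Real.exp (-Φ x) = m / n := by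
    rw [hΦx, Real.exp_neg, Real.exp_log (by positivity), inv_div]
  have htl : n * (muPhi Φ).real (Ioc (-(l * x)) (l * x))ᶜ ≤ m / 4 := by
    have h1 := mul_le_mul_of_nonneg_left (htail x hδx) (show (0 : ℝ) ≤ n by positivity)
    rw [hexp] at h1
    refine h1.trans_eq ?_
    have : (n : ℝ) ≠ 0 := by positivity
    field_simp
  refine le_trans (ENNReal.ofReal_le_ofReal ?_)
    (le_isoProfile_of_tail_le hconc hc hint hMpos.le hMN (by linarith) ht0 ht1 htl)
  set σ := (Φ (l * (l * x)) - Φ (l * x)) / (l * (l * x) - l * x) with hσ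
  -- Doubling twice gives `Φ (l² x) - Φ (l x) ≥ Φ (l x) ≥ 2 Φ x`, over an interval of length at most
  -- `l² x`.
  have hσ1 : Φ x / (l ^ 2 * x) ≤ σ := by
    rw [hσ]
    exact div_le_div₀ (by linarith) (by linarith) (by linarith) (by nlinarith)
  have hKΦ : Φ x - Φ 0 ≤ K * Φ x := by
    have h1 : |Φ 0| ≤ |Φ 0| / Real.log 2 * Φ x := by
      rw [div_mul_eq_mul_div, le_div_iff₀ hlog2]
      exact mul_le_mul_of_nonneg_left hΦx2 (abs_nonneg _)
    rw [hK, add_mul, one_mul]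
    linarith [neg_le_abs (Φ 0)]
  have hder : rightDeriv Φ x ≤ K * l ^ 2 * σ := by
    calc rightDeriv Φ x ≤ (Φ x - Φ 0) / x := rightDeriv_le_of_concaveOn hmono hconc hx0
      _ ≤ K * Φ x / x := div_le_div_of_nonneg_right hKΦ hx0.le
      _ = K * l ^ 2 * (Φ x / (l ^ 2 * x)) := by field_simp
      _ ≤ _ := mul_le_mul_of_nonneg_left hσ1 (by positivity)
  calc (K * l ^ 2 * (13 * √18))⁻¹ * m * rightDeriv Φ x
      ≤ (K * l ^ 2 * (13 * √18))⁻¹ * m * (K * l ^ 2 * σ) :=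
        mul_le_mul_of_nonneg_left hder (by positivity)
    _ = m * σ / (13 * √18) := by field_simp
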